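/- Let $M$ be a $C^\infty$ smooth Hausdorff paracompact $n$-dimensional manifold without boundary and let $1\le r\le\infty$. A (singular) foliation of class $C^r$ on $M$ is a partition $\mathcal F$ of $M$ into subsets, called leaves, possibly of different dimensions, such that: (a) each leaf $L$ is a weakly imbedded submanifold, i.e. $L$ carries a $C^r$-differentiable structure (of some dimension $k$) making it an immersed submanifold of $M$, such that for every locally connected topological space $N$ and every continuous map $f:N\to M$ with $f(N)\subset L$, the map $f:N\to L$ is continuous as well; (b) if $x$ belongs to a $k$-dimensional leaf, then there is a $C^r$ chart $(U,\phi)$ of $M$ with $x\in U$, $\phi(x)=0$ and $\phi(U)=V\times W$, where $V\subset\mathbb R^k$ and $W\subset\mathbb R^{n-k}$ are open, such that $\phi(L\cap U)=V\times\{w\in W:\phi^{-1}(0,w)\in L\}$ for every $L\in\mathcal F$. Let $\mathrm{Diff}^r(M,\mathcal F)$ be the group of all $C^r$ diffeomorphisms $f$ of $M$ with $f(L)=L$ for every leaf $L$. For a group $G$ of $C^r$ diffeomorphisms of $M$ and a set $U\subset M$, let $G_U$ be the group of all $g$ for which there are a compact set $K\subset U$ and a map $\mathbb R\times M\ni(t,x)\mapsto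 f_t(x)\in M$ of class $C^r$ with $f_t\in G$ and $f_t=\mathrm{id}$ off $K$ for all $t$, $f_0=\mathrm{id}$ and $f_1=g$ (the identity component of the group of elements of $G$ compactly supported in $U$). Set $G_{\mathcal F}=\mathrm{Diff}^r_c(M,\mathcal F)_0:=\mathrm{Diff}^r(M,\mathcal F)_M$, i.e. the group of all leaf preserving $C^r$ diffeomorphisms that can be joined to the identity by a compactly supported $C^r$ isotopy of leaf preserving diffeomorphisms. Then, for every foliation $\mathcal F$ of class $C^r$ on $M$, the group $G=G_{\mathcal F}$ is factorizable: for every open cover $\mathcal U$ of $M$ and every $g\in G$ there are finitely many $g_1,\dots,g_m\in G$ and $U_1,\dots,U_m\in\mathcal U$ such that $g=g_1\cdots g_m$ and $g_i\in G_{U_i}$ for $i=1,\dots,m$. -/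

import Mathlib

open scoped Manifold ContDiff

universe u

namespace FoliatedManifold

/-- `C^r` diffeomorphisms of `M` form a group under composition: `(f * g) x = f (g x)`. -/
noncomputable instance instGroupDiffeomorph {n : ℕ} {M : Type u} [TopologicalSpace M]
    [ChartedSpace (EuclideanSpace ℝ (Fin n)) M] {r : ℕ∞ω} :
    Group (Diffeomorph (𝓡 n) (𝓡 n) M M r) where
  mul f g := g.trans f
  one := Diffeomorph.refl (𝓡 n) M r
  inv f := f.symm
  mul_assoc _ _ _ := Diffeomorph.ext fun _ => rfl
  one_mul _ := Diffeomorph.ext fun _ => rfl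
  mul_one _ := Diffeomorph.ext fun _ => rfl
  inv_mul_cancel f := Diffeomorph.ext fun x => f.symm_apply_apply x

section Group

variable {n : ℕ} {M : Type u} [TopologicalSpace M]
  [ChartedSpace (EuclideanSpace ℝ (Fin n)) M] {r : ℕ∞ω}

theorem diffeo_mul_apply (f g : Diffeomorph (𝓡 n) (𝓡 n) M M r) (x : M) :
    (f * g) x = f (g x) := rfl

theorem diffeo_one_apply (x : M) : (1 : Diffeomorph (𝓡 n) (𝓡 n) M M r) x = x := rfl

theorem diffeo_inv_apply (f : Diffeomorph (𝓡 n) (𝓡 n) M M r) (x : M) :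
    f⁻¹ x = f.symm x := rfl

/-- `f = (f_t)` is a `C^r` isotopy through elements of `G`, starting at the identity, with all
`f_t` equal to the identity off the set `K`.  The class `C^r` refers to `(t, x) ↦ f_t(x)`. -/
structure IsIsotopyIn (G : Subgroup (Diffeomorph (𝓡 n) (𝓡 n) M M r)) (K : Set M)
    (f : ℝ → Diffeomorph (𝓡 n) (𝓡 n) M M r) : Prop where
  contMDiff : ContMDiff (𝓘(ℝ, ℝ).prod (𝓡 n)) (𝓡 n) r (fun p : ℝ × M => f p.1 p.2)
  mem : ∀ t, f t ∈ G
  map_zero : f 0 = 1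
  eq_off : ∀ t, ∀ x ∉ K, f t x = x

/-- The identity component `G_U` of the group of elements of `G` compactly supported in `U`:
the end points of isotopies through elements of `G` that start at the identity and are
supported in one compact subset of `U`.  For `U = M` this is the compactly supported
identity component of `G`. -/
noncomputable def isotopyComponent (G : Subgroup (Diffeomorph (𝓡 n) (𝓡 n) M M r)) (U : Set M) :
    Subgroup (Diffeomorph (𝓡 n) (𝓡 n) M M r) where
  carrier := {g | ∃ K : Set M, IsCompact K ∧ K ⊆ U ∧
    ∃ f : ℝ → Diffeomorph (𝓡 n) (𝓡 n) M M r, IsIsotopyIn G K f ∧ f 1 = g}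
  one_mem' := by
    refine ⟨∅, isCompact_empty, Set.empty_subset _, fun _ => 1, ⟨?_, ?_, rfl, ?_⟩, rfl⟩
    · exact contMDiff_snd
    · exact fun _ => G.one_mem
    · exact fun _ _ _ => rfl
  mul_mem' := by
    rintro g g' ⟨K, hK, hKU, f, hf, rfl⟩ ⟨K', hK', hKU', f', hf', rfl⟩
    refine ⟨K ∪ K', hK.union hK', Set.union_subset hKU hKU', fun t => f t * f' t,
      ⟨?_, ?_, ?_, ?_⟩, rfl⟩
    · exact hf.contMDiff.comp (contMDiff_fst.prodMk hf'.contMDiff)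
    · exact fun t => G.mul_mem (hf.mem t) (hf'.mem t)
    · simp [hf.map_zero, hf'.map_zero]
    · intro t x hx
      rw [Set.mem_union, not_or] at hx
      rw [diffeo_mul_apply, hf'.eq_off t x hx.2, hf.eq_off t x hx.1]
  inv_mem' := by
    rintro g ⟨K, hK, hKU, f, hf, rfl⟩
    refine ⟨K, hK, hKU, fun t => f (1 - t) * (f 1)⁻¹, ⟨?_, ?_, ?_, ?_⟩, ?_⟩
    · have h1 : ContMDiff (𝓘(ℝ, ℝ).prod (𝓡 n)) 𝓘(ℝ, ℝ) r (fun p : ℝ × M => 1 - p.1) :=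
        (contDiff_const.sub contDiff_id : ContDiff ℝ r fun t : ℝ => 1 - t).contMDiff.comp
          contMDiff_fst
      exact hf.contMDiff.comp (h1.prodMk ((f 1).symm.contMDiff.comp contMDiff_snd))
    · exact fun t => G.mul_mem (hf.mem _) (G.inv_mem (hf.mem 1))
    · simp
    · intro t x hx
      have h : (f 1)⁻¹ x = x := by
        rw [diffeo_inv_apply]
        conv_lhs => rw [← hf.eq_off 1 x hx]
        exact (f 1).symm_apply_apply x
      rw [diffeo_mul_apply, h, hf.eq_off _ x hx]
    · simp [hf.map_zero]

/-- A group `G` of `C^r` diffeomorphisms is factorizable if, for every open cover, each `g ∈ G` is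
a finite product of elements of the groups `G_U`, with `U` in the cover. -/
def IsFactorizable (G : Subgroup (Diffeomorph (𝓡 n) (𝓡 n) M M r)) : Prop :=
  ∀ 𝒰 : Set (Set M), (∀ U ∈ 𝒰, IsOpen U) → ⋃₀ 𝒰 = Set.univ →
    ∀ g ∈ G, ∃ l : List (Diffeomorph (𝓡 n) (𝓡 n) M M r),
      (∀ h ∈ l, ∃ U ∈ 𝒰, h ∈ isotopyComponent G U) ∧ l.prod = g

end Group

section Foliation

variable {n : ℕ} {M : Type u} [TopologicalSpace M]
  [ChartedSpace (EuclideanSpace ℝ (Fin n)) M]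

/-- `L ⊆ M` carries a `C^r` structure of dimension `k` (presented as the image of an injective
immersion `ι : S → M` of a `C^r` manifold `S`) for which it is a weakly imbedded submanifold: every
map from a locally connected space to `L` that is continuous into `M` is continuous into `L`.
Spaces `N` in the universe of `M` suffice: for a map `f` from a larger space, give the
set `L` the topology coinduced by `f`, which is again locally connected. -/
def IsWeaklyImbedded (r : ℕ∞ω) (k : ℕ) (L : Set M) : Prop :=
  ∃ (S : Type u) (_ : TopologicalSpace S) (_ : ChartedSpace (EuclideanSpace ℝ (Fin k)) S)
    (_ : IsManifold (𝓡 k) r S) (ι : S → M),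
    Function.Injective ι ∧ Set.range ι = L ∧ Manifold.IsImmersion (𝓡 k) (𝓡 n) r ι ∧
    ∀ (N : Type u) [TopologicalSpace N] [LocallyConnectedSpace N] (f : N → S),
      Continuous (ι ∘ f) → Continuous f

/-- At `x` there is a `C^r` chart `φ` of `M` with values in `ℝ^k × ℝ^(n-k)` that is distinguished
for the partition `𝓛`: it is centred at `x`, its image is a product `V × W`, and every `L` in
`𝓛` appears in it as `V × l` with `l = {w ∈ W | φ⁻¹(0, w) ∈ L}`. -/
def HasDistinguishedChart (r : ℕ∞ω) (k : ℕ) (𝓛 : Set (Set M)) (x : M) : Prop :=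
  ∃ φ : OpenPartialHomeomorph M
      (EuclideanSpace ℝ (Fin k) × EuclideanSpace ℝ (Fin (n - k))),
    ContMDiffOn (𝓡 n) 𝓘(ℝ, EuclideanSpace ℝ (Fin k) × EuclideanSpace ℝ (Fin (n - k))) r
      φ φ.source ∧
    ContMDiffOn 𝓘(ℝ, EuclideanSpace ℝ (Fin k) × EuclideanSpace ℝ (Fin (n - k))) (𝓡 n) r
      φ.symm φ.target ∧
    x ∈ φ.source ∧ φ x = 0 ∧
    ∃ (V : Set (EuclideanSpace ℝ (Fin k))) (W : Set (EuclideanSpace ℝ (Fin (n - k)))),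
      IsOpen V ∧ IsOpen W ∧ φ.target = V ×ˢ W ∧
      ∀ L ∈ 𝓛, φ '' (L ∩ φ.source) = V ×ˢ {w ∈ W | φ.symm (0, w) ∈ L}

variable (n M) in
/-- A (singular) foliation of class `C^r`: a partition of `M` into weakly imbedded submanifolds,
the leaves, possibly of different dimensions, with a distinguished chart at each point. -/
structure Foliation (r : ℕ∞ω) where
  leaves : Set (Set M)
  isPartition : Setoid.IsPartition leaves
  exists_dim : ∀ L ∈ leaves, ∃ k : ℕ, IsWeaklyImbedded (n := n) r k L ∧
    ∀ x ∈ L, HasDistinguishedChart (n := n) r k leaves x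

variable {r : ℕ∞ω}

/-- The group `Diff^r(M, F)` of leaf preserving `C^r` diffeomorphisms: `f(L) = L` for
every leaf `L`. -/
noncomputable def Foliation.leafPreserving (F : Foliation n M r) :
    Subgroup (Diffeomorph (𝓡 n) (𝓡 n) M M r) where
  carrier := {f | ∀ L ∈ F.leaves, f '' L = L}
  one_mem' := fun L _ => Set.image_id L
  mul_mem' := by
    intro f g hf hg L hL
    have h : ⇑(f * g) = f ∘ g := rfl
    rw [h, Set.image_comp, hg L hL, hf L hL]
  inv_mem' := by
    intro f hf L hL
    have h : ⇑f⁻¹ = ⇑f.symm := rfl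
    rw [h]
    conv_lhs => rw [← hf L hL]
    exact f.symm_image_image L

/-- The group `G_F = Diff^r_c(M, F)_0` of the leaf preserving diffeomorphisms that can be joined to
the identity by a compactly supported isotopy of leaf preserving diffeomorphisms. -/
noncomputable def Foliation.group (F : Foliation n M r) : Subgroup (Diffeomorph (𝓡 n) (𝓡 n) M M r) :=
  isotopyComponent F.leafPreserving Set.univ

end Foliation

end FoliatedManifold

/-! The idea is to cut an isotopy `g` off in time. For a function `ψ` on `M` and small `τ` the map
`x ↦ g_{τψ(x)}(x)` is near the identity, so by the inverse function theorem it is a diffeomorphism,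
and it maps each leaf to itself because every `g_t` does. Changing `ψ` by a bump function supported
in a member `U` of the cover changes this diffeomorphism by an element of `G_U`. Finitely many such
changes lead from `ψ = 0`, which gives the identity, to a `ψ` equal to `1` on the support of `g`,
which gives `g_τ`. Hence `g_t` is constant, locally in `t`, modulo the subgroup generated by the
groups `G_U`, and the connectedness of `ℝ` carries this from time `0` to time `1`. -/

namespace FoliatedManifold

open Set Filter Topology

section InverseFunctionTheorem

variable {𝕜 : Type*} [RCLike 𝕜] {r : ℕ∞ω}
  {E : Type*} [NormedAddCommGroup E] [NormedSpace 𝕜 E]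
  {F : Type*} [NormedAddCommGroup F] [NormedSpace 𝕜 F]

theorem isLocalDiffeomorphAt_of_hasFDerivAt_equiv [CompleteSpace E] {f : E → F} {x : E}
    (hr : 1 ≤ r) (hf : ∀ᶠ y in 𝓝 x, ContDiffAt 𝕜 r f y) {L : E ≃L[𝕜] F}
    (hL : HasFDerivAt f (L : E →L[𝕜] F) x) :
    IsLocalDiffeomorphAt 𝓘(𝕜, E) 𝓘(𝕜, F) r f x := by
  have hr₀ : r ≠ 0 := (zero_lt_one.trans_le hr).ne'
  have fderiv_invertible : ∀ᶠ y in 𝓝 x, fderiv 𝕜 f y ∈ range ((↑) : (E ≃L[𝕜] F) → E →L[𝕜] F) := by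
    refine (hf.self_of_nhds.fderiv_right (m := 0) (by simpa using hr)).continuousAt ?_
    rw [hL.fderiv]
    exact ContinuousLinearEquiv.nhds L
  obtain ⟨U, hU, hUo, hxU⟩ := eventually_nhds_iff.1 (hf.and fderiv_invertible)
  let e := (hf.self_of_nhds.toOpenPartialHomeomorph f hL hr₀).restrOpen U hUo
  have mem_U : ∀ y ∈ e.target, e.symm y ∈ U := fun y hy => (e.map_target hy).2
  refine ⟨⟨e.toPartialEquiv, e.open_source, e.open_target, ?_, ?_⟩, ?_, fun y _ => rfl⟩
  · exact contMDiffOn_iff_contDiffOn.2 fun y hy => (hU y hy.2).1.contDiffWithinAt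
  · refine contMDiffOn_iff_contDiffOn.2 fun y hy => ContDiffAt.contDiffWithinAt ?_
    obtain ⟨hfy, B, hB⟩ := hU _ (mem_U y hy)
    refine e.contDiffAt_symm (f₀' := B) hy ?_ hfy
    rw [hB]
    exact (hfy.differentiableAt hr₀).hasFDerivAt
  · exact ⟨hf.self_of_nhds.mem_toOpenPartialHomeomorph_source hL hr₀, hxU⟩

variable {H : Type*} [TopologicalSpace H] {I : ModelWithCorners 𝕜 E H}
  {H' : Type*} [TopologicalSpace H'] {J : ModelWithCorners 𝕜 F H'}
  {M : Type*} [TopologicalSpace M] [ChartedSpace H M]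
  {N : Type*} [TopologicalSpace N] [ChartedSpace H' N]

theorem isLocalDiffeomorphAt_congr_of_eventuallyEq {f g : M → N} {x : M}
    (hg : IsLocalDiffeomorphAt I J r g x) (hfg : f =ᶠ[𝓝 x] g) :
    IsLocalDiffeomorphAt I J r f x := by
  obtain ⟨e, hx, heq⟩ := hg
  obtain ⟨U, hU, hUo, hxU⟩ := eventually_nhds_iff.1 hfg
  let e' := e.toOpenPartialHomeomorph.restrOpen U hUo
  refine ⟨⟨e'.toPartialEquiv, e'.open_source, e'.open_target, ?_, ?_⟩, ⟨hx, hxU⟩,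
    fun y hy => (hU y hy.2).trans (heq hy.1)⟩
  · exact e.contMDiffOn_toFun.mono inter_subset_left
  · exact e.contMDiffOn_invFun.mono inter_subset_left

variable (r I) in
/-- The extended chart at a point of a boundaryless `C^r` manifold, as a partial diffeomorphism
to the model vector space. -/
noncomputable def extChartPartialDiffeomorph [I.Boundaryless] [IsManifold I r M] (x : M) :
    PartialDiffeomorph I 𝓘(𝕜, E) M E r where
  toPartialEquiv := extChartAt I x
  open_source := isOpen_extChartAt_source x
  open_target := isOpen_extChartAt_target x
  contMDiffOn_toFun := by simpa only [extChartAt_source] using contMDiffOn_extChartAt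
  contMDiffOn_invFun := contMDiffOn_extChartAt_symm x

theorem isLocalDiffeomorphAt_of_hasMFDerivAt_equiv [CompleteSpace E]
    [I.Boundaryless] [J.Boundaryless] [IsManifold I r M] [IsManifold J r N]
    {f : M → N} {x : M} (hr : 1 ≤ r) (hf : ∀ᶠ y in 𝓝 x, ContMDiffAt I J r f y)
    {L : TangentSpace I x ≃L[𝕜] TangentSpace J (f x)}
    (hL : HasMFDerivAt I J f x (L : TangentSpace I x →L[𝕜] TangentSpace J (f x))) :
    IsLocalDiffeomorphAt I J r f x := by
  set c := extChartAt I x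
  set d := extChartAt J (f x)
  have hx : x ∈ c.source := mem_extChartAt_source x
  have hfx : f x ∈ d.source := mem_extChartAt_source (f x)
  have near_source : ∀ᶠ y in 𝓝 x, y ∈ c.source ∧ f y ∈ d.source :=
    (eventually_mem_set.2 (extChartAt_source_mem_nhds x)).and
      (hL.continuousAt.eventually (extChartAt_source_mem_nhds (f x)))
  have symm_tendsto : Tendsto c.symm (𝓝 (c x)) (𝓝 x) := by
    simpa only [ContinuousAt, extChartAt_to_inv] using continuousAt_extChartAt_symm (I := I) x
  have hwritten : ∀ᶠ u in 𝓝 (c x), ContDiffAt 𝕜 r (d ∘ f ∘ c.symm) u := by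
    filter_upwards [symm_tendsto.eventually (hf.and near_source),
      extChartAt_target_mem_nhds (I := I) x] with u ⟨hfu, _, hdu⟩ hu
    refine ContMDiffAt.contDiffAt (ContMDiffAt.comp u ?_ (ContMDiffAt.comp u hfu ?_))
    · exact contMDiffAt_extChartAt' (by simpa only [d, extChartAt_source] using! hdu)
    · exact (contMDiffOn_extChartAt_symm x).contMDiffAt (extChartAt_target_mem_nhds' hu)
  let L₀ : E ≃L[𝕜] F := L
  have hderiv : HasFDerivAt (d ∘ f ∘ c.symm) (L₀ : E →L[𝕜] F) (c x) := by
    have h : HasFDerivWithinAt (d ∘ f ∘ c.symm) (L₀ : E →L[𝕜] F) (range I) (c x) := hL.2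
    rwa [I.range_eq_univ, hasFDerivWithinAt_univ] at h
  have hd : (d ∘ f ∘ c.symm) (c x) ∈ d.target := by
    simpa only [Function.comp, c.left_inv hx] using d.map_source hfx
  have chart_local : IsLocalDiffeomorphAt I 𝓘(𝕜, E) r c x :=
    (extChartPartialDiffeomorph r I x).isLocalDiffeomorphAt _ _ _ hx
  have symm_local : IsLocalDiffeomorphAt 𝓘(𝕜, F) J r d.symm ((d ∘ f ∘ c.symm) (c x)) :=
    (extChartPartialDiffeomorph r J (f x)).symm.isLocalDiffeomorphAt _ _ _ hd
  have hlocal : IsLocalDiffeomorphAt I J r (d.symm ∘ (d ∘ f ∘ c.symm) ∘ c) x :=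
    (chart_local.comp _ _
      (isLocalDiffeomorphAt_of_hasFDerivAt_equiv hr hwritten hderiv)).comp _ _ symm_local
  refine isLocalDiffeomorphAt_congr_of_eventuallyEq hlocal ?_
  filter_upwards [near_source] with y ⟨hyc, hyd⟩
  change f y = d.symm (d (f (c.symm (c y))))
  rw [c.left_inv hyc, d.left_inv hyd]

end InverseFunctionTheorem

section Track

variable {𝕜 : Type*} [RCLike 𝕜] {r : ℕ∞ω}
  {B : Type*} [NormedAddCommGroup B] [NormedSpace 𝕜 B]
  {E : Type*} [NormedAddCommGroup E] [NormedSpace 𝕜 E]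
  {F : Type*} [NormedAddCommGroup F] [NormedSpace 𝕜 F]
  {A : Type*} [TopologicalSpace A] {I₀ : ModelWithCorners 𝕜 B A}
  {H : Type*} [TopologicalSpace H] {I : ModelWithCorners 𝕜 E H}
  {H' : Type*} [TopologicalSpace H'] {J : ModelWithCorners 𝕜 F H'}
  {T : Type*} [TopologicalSpace T] [ChartedSpace A T]
  {M : Type*} [TopologicalSpace M] [ChartedSpace H M]
  {N : Type*} [TopologicalSpace N] [ChartedSpace H' N]
  {Φ : T → M → N} {t : T} {x : M}

/-- The track of a family of maps `Φ t`, in the sense in which one speaks of the track of an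
isotopy: the map `(t, x) ↦ (t, Φ t x)`. -/
def track {T M N : Type*} (Φ : T → M → N) (p : T × M) : T × N := (p.1, Φ p.1 p.2)

/-- The derivative of the track is block triangular with diagonal blocks `id` and `d(Φ t)`. -/
theorem isLocalDiffeomorphAt_track [CompleteSpace B] [CompleteSpace E]
    [I₀.Boundaryless] [I.Boundaryless] [J.Boundaryless]
    [IsManifold I₀ r T] [IsManifold I r M] [IsManifold J r N] (hr : 1 ≤ r)
    (hΦ : ContMDiff (I₀.prod I) J r (fun p : T × M => Φ p.1 p.2))
    {L : TangentSpace I x ≃L[𝕜] TangentSpace J (Φ t x)}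
    (hL : HasMFDerivAt I J (Φ t) x (L : TangentSpace I x →L[𝕜] TangentSpace J (Φ t x))) :
    IsLocalDiffeomorphAt (I₀.prod I) (I₀.prod J) r (track Φ) (t, x) := by
  have hΦ_at : MDifferentiableAt (I₀.prod I) J (fun p : T × M => Φ p.1 p.2) (t, x) :=
    hΦ.mdifferentiable (zero_lt_one.trans_le hr).ne' (t, x)
  let S : (B × E) ≃L[𝕜] (B × F) := ContinuousLinearEquiv.skewProd
    (ContinuousLinearEquiv.refl 𝕜 B) L (mfderiv I₀ J (fun s => Φ s x) t)
  have hS : HasMFDerivAt (I₀.prod I) (I₀.prod J) (track Φ) (t, x)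
      (S : (B × E) →L[𝕜] (B × F)) := by
    refine ((hasMFDerivAt_fst (t, x)).prodMk hΦ_at.hasMFDerivAt).congr_mfderiv
      (ContinuousLinearMap.ext fun v => ?_)
    have hsum := mfderiv_prod_eq_add_apply hΦ_at (v := v)
    rw [hL.mfderiv] at hsum
    exact Prod.ext rfl (hsum.trans (add_comm _ _))
  have htrack : ContMDiff (I₀.prod I) (I₀.prod J) r (track Φ) := contMDiff_fst.prodMk hΦ
  exact isLocalDiffeomorphAt_of_hasMFDerivAt_equiv hr (Eventually.of_forall htrack) (L := S) hS

theorem isLocalDiffeomorphAt_track_of_eventuallyEq_id [CompleteSpace B] [CompleteSpace E]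
    [I₀.Boundaryless] [I.Boundaryless] [IsManifold I₀ r T] [IsManifold I r M] (hr : 1 ≤ r)
    {Φ : T → M → M} (hΦ : ContMDiff (I₀.prod I) I r (fun p : T × M => Φ p.1 p.2))
    (hid : Φ t =ᶠ[𝓝 x] id) :
    IsLocalDiffeomorphAt (I₀.prod I) (I₀.prod I) r (track Φ) (t, x) :=
  isLocalDiffeomorphAt_track hr hΦ (L := ContinuousLinearEquiv.refl 𝕜 E)
    ((hasMFDerivAt_id x).congr_of_eventuallyEq hid)

theorem isLocalDiffeomorphAt_of_track
    (h : IsLocalDiffeomorphAt (I₀.prod I) (I₀.prod J) r (track Φ) (t, x)) :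
    IsLocalDiffeomorphAt I J r (Φ t) x := by
  obtain ⟨e, hx, heq⟩ := h
  have fst_symm : ∀ q ∈ e.target, (e.symm q).1 = q.1 := fun q hq =>
    congrArg Prod.fst ((heq (e.map_target hq)).trans (e.right_inv hq))
  have symm_slice : ∀ y, (t, y) ∈ e.target → (t, (e.symm (t, y)).2) = e.symm (t, y) :=
    fun y hy => Prod.ext (fst_symm _ hy).symm rfl
  have slice_mem : ∀ y, (t, y) ∈ e.target → (t, (e.symm (t, y)).2) ∈ e.source :=
    fun y hy => by rw [symm_slice y hy]; exact e.map_target hy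
  refine ⟨⟨⟨Φ t, fun y => (e.symm (t, y)).2, {y | (t, y) ∈ e.source}, {y | (t, y) ∈ e.target},
      fun y hy => ?_, slice_mem, fun y hy => ?_, fun y hy => ?_⟩, ?_, ?_, ?_, ?_⟩, hx,
      fun _ _ => rfl⟩
  · exact (mem_of_eq_of_mem (heq hy) (e.map_source hy) : track Φ (t, y) ∈ e.target)
  · exact congrArg Prod.snd ((congrArg e.symm (heq hy)).trans (e.left_inv hy))
  · have h := (heq (slice_mem y hy)).trans ((congrArg e (symm_slice y hy)).trans (e.right_inv hy))
    exact congrArg Prod.snd h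
  · exact e.open_source.preimage (Continuous.prodMk_right t)
  · exact e.open_target.preimage (Continuous.prodMk_right t)
  · exact contMDiff_snd.comp_contMDiffOn ((e.contMDiffOn_toFun.congr heq).comp
      (contMDiff_const.prodMk contMDiff_id).contMDiffOn fun _ hy => hy)
  · exact contMDiff_snd.comp_contMDiffOn
      (e.contMDiffOn_invFun.comp (contMDiff_const.prodMk contMDiff_id).contMDiffOn fun _ hy => hy)

theorem contMDiff_symm_family [CompleteSpace B] [CompleteSpace E]
    [I₀.Boundaryless] [I.Boundaryless] [J.Boundaryless]
    [IsManifold I₀ r T] [IsManifold I r M] [IsManifold J r N] (hr : 1 ≤ r)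
    {f : T → Diffeomorph I J M N r}
    (hf : ContMDiff (I₀.prod I) J r (fun p : T × M => f p.1 p.2)) :
    ContMDiff (I₀.prod J) I r (fun p : T × N => (f p.1).symm p.2) := by
  have hr₀ : r ≠ 0 := (zero_lt_one.trans_le hr).ne'
  have hlocal : IsLocalDiffeomorph (I₀.prod I) (I₀.prod J) r (track fun t => f t) := fun p =>
    isLocalDiffeomorphAt_track hr hf (L := (f p.1).mfderivToContinuousLinearEquiv hr₀ p.2)
      ((f p.1).mdifferentiable hr₀ p.2).hasMFDerivAt
  have hbij : Function.Bijective (track fun t => f t) := by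
    refine ⟨fun ⟨t, x⟩ ⟨t', x'⟩ h => ?_, fun q => ⟨(q.1, (f q.1).symm q.2), ?_⟩⟩
    · obtain rfl : t = t' := congrArg Prod.fst h
      exact congrArg (Prod.mk t) ((f t).injective (congrArg Prod.snd h))
    · exact Prod.ext rfl ((f q.1).apply_symm_apply q.2)
  let e := hlocal.diffeomorphOfBijective hbij
  have he : ∀ q, e.symm q = (q.1, (f q.1).symm q.2) := fun q =>
    e.injective ((e.apply_symm_apply q).trans (Prod.ext rfl ((f q.1).apply_symm_apply q.2).symm))
  exact (contMDiff_snd.comp e.symm.contMDiff).congr fun q => (congrArg Prod.snd (he q)).symm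

end Track

section CompactlySupportedFamily

variable {T M N : Type*} [TopologicalSpace T] [TopologicalSpace M] [TopologicalSpace N]
  {t₀ : T} {K : Set M}

theorem eventually_injOn_of_injOn_track [T2Space N] {Φ : T → M → N}
    (hΦ : Continuous fun p : T × M => Φ p.1 p.2) (hK : IsCompact K) (hinj : InjOn (Φ t₀) K)
    (hloc : ∀ x ∈ K, ∃ u ∈ 𝓝 (t₀, x), InjOn (track Φ) u) :
    ∀ᶠ t in 𝓝 t₀, InjOn (Φ t) K := by
  have pairs : ∀ᶠ t in 𝓝 t₀, ∀ q ∈ K ×ˢ K, Φ t q.1 = Φ t q.2 → q.1 = q.2 := by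
    refine (hK.prod hK).eventually_forall_of_forall_eventually
      (P := fun t q => Φ t q.1 = Φ t q.2 → q.1 = q.2) fun ⟨x, y⟩ ⟨hx, hy⟩ => ?_
    have hfst : ContinuousAt (fun z : T × M × M => (z.1, z.2.1)) (t₀, x, y) := by fun_prop
    have hsnd : ContinuousAt (fun z : T × M × M => (z.1, z.2.2)) (t₀, x, y) := by fun_prop
    obtain rfl | hxy := eq_or_ne x y
    · obtain ⟨u, hu, hinj_u⟩ := hloc x hx
      filter_upwards [hfst.eventually hu, hsnd.eventually hu] with z h₁ h₂ h
      exact congrArg Prod.snd (hinj_u h₁ h₂ (Prod.ext rfl h))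
    · have values_ne : ∀ᶠ z : T × M × M in 𝓝 (t₀, x, y), Φ z.1 z.2.1 ≠ Φ z.1 z.2.2 :=
        ((hΦ.continuousAt.comp hfst).ne_iff_eventually_ne (hΦ.continuousAt.comp hsnd)).1
          (hinj.ne hx hy hxy)
      exact values_ne.mono fun z hz h => absurd h hz
  exact pairs.mono fun t ht x hx y hy => ht (x, y) ⟨hx, hy⟩

theorem injective_of_injOn_of_eqOn_compl {α : Type*} {f : α → α} {s s' : Set α} (hss' : s ⊆ s')
    (hinj : InjOn f s') (hmaps : MapsTo f s s') (hoff : EqOn f id sᶜ) : Function.Injective f := by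
  have eq_of_notMem : ∀ x, ∀ y ∉ s, f x = f y → x = y := by
    intro x y hy hxy
    by_cases hx : x ∈ s
    · refine hinj (hss' hx) ?_ hxy
      simpa only [hxy, hoff hy, id_eq] using hmaps hx
    · simpa only [hoff hx, hoff hy, id_eq] using hxy
  intro x y hxy
  by_cases hy : y ∈ s
  · by_cases hx : x ∈ s
    · exact hinj (hss' hx) (hss' hy) hxy
    · exact (eq_of_notMem y x hx hxy.symm).symm
  · exact eq_of_notMem x y hy hxy

variable {Φ : T → M → M}

theorem eventually_injective [T2Space M] [LocallyCompactSpace M]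
    (hΦ : Continuous fun p : T × M => Φ p.1 p.2) (hid : Φ t₀ = id) (hK : IsCompact K)
    (hoff : ∀ t, EqOn (Φ t) id Kᶜ) (hloc : ∀ x, ∃ u ∈ 𝓝 (t₀, x), InjOn (track Φ) u) :
    ∀ᶠ t in 𝓝 t₀, Function.Injective (Φ t) := by
  obtain ⟨K', hK', hKK'⟩ := exists_compact_superset hK
  have hmaps : ∀ᶠ t in 𝓝 t₀, ∀ x ∈ K, Φ t x ∈ K' := by
    refine hK.eventually_forall_of_forall_eventually fun x hx => ?_
    refine hΦ.continuousAt.eventually_mem (x := (t₀, x)) ?_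
    simpa only [hid, id_eq] using mem_interior_iff_mem_nhds.1 (hKK' hx)
  have hinj := eventually_injOn_of_injOn_track hΦ hK' (hid ▸ injOn_id K') fun x _ => hloc x
  filter_upwards [hmaps, hinj] with t hmaps hinj
  exact injective_of_injOn_of_eqOn_compl (hKK'.trans interior_subset) hinj hmaps (hoff t)

theorem eventually_surjective (hK : IsCompact K) (hoff : ∀ t, EqOn (Φ t) id Kᶜ)
    (hloc : ∀ y ∈ K, range (track Φ) ∈ 𝓝 (t₀, y)) :
    ∀ᶠ t in 𝓝 t₀, Function.Surjective (Φ t) := by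
  have hrange : ∀ᶠ t in 𝓝 t₀, ∀ y ∈ K, (t, y) ∈ range (track Φ) :=
    hK.eventually_forall_of_forall_eventually fun y hy => hloc y hy
  filter_upwards [hrange] with t ht y
  by_cases hy : y ∈ K
  · obtain ⟨⟨s, x⟩, hx⟩ := ht y hy
    obtain rfl : s = t := congrArg Prod.fst hx
    exact ⟨x, congrArg Prod.snd hx⟩
  · exact ⟨y, hoff t hy⟩

variable {𝕜 : Type*} [RCLike 𝕜] {r : ℕ∞ω}
  {B : Type*} [NormedAddCommGroup B] [NormedSpace 𝕜 B] [CompleteSpace B]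
  {E : Type*} [NormedAddCommGroup E] [NormedSpace 𝕜 E] [CompleteSpace E]
  {A : Type*} [TopologicalSpace A] {I₀ : ModelWithCorners 𝕜 B A} [I₀.Boundaryless]
  {H : Type*} [TopologicalSpace H] {I : ModelWithCorners 𝕜 E H} [I.Boundaryless]
  [ChartedSpace A T] [IsManifold I₀ r T] [ChartedSpace H M] [IsManifold I r M]

theorem eventually_isLocalDiffeomorph [T2Space M] (hr : 1 ≤ r)
    (hΦ : ContMDiff (I₀.prod I) I r (fun p : T × M => Φ p.1 p.2)) (hid : Φ t₀ = id)
    (hK : IsCompact K) (hoff : ∀ t, EqOn (Φ t) id Kᶜ) :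
    ∀ᶠ t in 𝓝 t₀, IsLocalDiffeomorph I I r (Φ t) := by
  have on_K : ∀ᶠ t in 𝓝 t₀, ∀ x ∈ K,
      IsLocalDiffeomorphAt (I₀.prod I) (I₀.prod I) r (track Φ) (t, x) := by
    refine hK.eventually_forall_of_forall_eventually fun x _ => ?_
    obtain ⟨e, hx, heq⟩ := isLocalDiffeomorphAt_track_of_eventuallyEq_id (t := t₀) (x := x) hr hΦ
      (.of_eq hid)
    exact mem_of_superset (e.open_source.mem_nhds hx) fun p hp => ⟨e, hp, heq⟩
  filter_upwards [on_K] with t ht x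
  apply isLocalDiffeomorphAt_of_track (I₀ := I₀)
  by_cases hx : x ∈ K
  · exact ht x hx
  · exact isLocalDiffeomorphAt_track_of_eventuallyEq_id hr hΦ
      ((hoff t).eventuallyEq_of_mem (hK.isClosed.isOpen_compl.mem_nhds hx))

theorem eventually_exists_diffeomorph [T2Space M] [LocallyCompactSpace M] (hr : 1 ≤ r)
    (hΦ : ContMDiff (I₀.prod I) I r (fun p : T × M => Φ p.1 p.2)) (hid : Φ t₀ = id)
    (hK : IsCompact K) (hoff : ∀ t, EqOn (Φ t) id Kᶜ) :
    ∀ᶠ t in 𝓝 t₀, ∃ d : Diffeomorph I I M M r, ⇑d = Φ t := by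
  have hlocal (x : M) : IsLocalDiffeomorphAt (I₀.prod I) (I₀.prod I) r (track Φ) (t₀, x) :=
    isLocalDiffeomorphAt_track_of_eventuallyEq_id hr hΦ (.of_eq hid)
  have hinj (x : M) : ∃ u ∈ 𝓝 (t₀, x), InjOn (track Φ) u := by
    obtain ⟨e, hx, heq⟩ := hlocal x
    exact ⟨e.source, e.open_source.mem_nhds hx, e.injOn.congr heq.symm⟩
  have hrange (y : M) : range (track Φ) ∈ 𝓝 (t₀, y) := by
    obtain ⟨e, hy, heq⟩ := hlocal y
    have htrack : e (t₀, y) = (t₀, y) := (heq hy).symm.trans (Prod.ext rfl (congrFun hid y))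
    refine mem_of_superset (e.open_target.mem_nhds (htrack ▸ e.map_source hy)) fun q hq => ?_
    exact ⟨e.symm q, (heq (e.map_target hq)).trans (e.right_inv hq)⟩
  filter_upwards [eventually_injective hΦ.continuous hid hK hoff hinj,
    eventually_surjective hK hoff fun y _ => hrange y,
    eventually_isLocalDiffeomorph hr hΦ hid hK hoff] with t hinj hsurj hlocal
  exact ⟨hlocal.diffeomorphOfBijective ⟨hinj, hsurj⟩, rfl⟩

end CompactlySupportedFamily

theorem mul_inv_mem_of_eventually {X G : Type*} [TopologicalSpace X] [PreconnectedSpace X]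
    [Group G] {H : Subgroup G} {f : X → G} (h : ∀ x, ∀ᶠ y in 𝓝 x, f y * (f x)⁻¹ ∈ H) (x y : X) :
    f y * (f x)⁻¹ ∈ H := by
  refine PreconnectedSpace.induction₂' (fun x y => f y * (f x)⁻¹ ∈ H) (fun x => ?_)
    ⟨fun x y z hxy hyz => ?_⟩ x y
  · filter_upwards [h x] with y hy
    exact ⟨hy, by simpa only [mul_inv_rev, inv_inv] using inv_mem hy⟩
  · simpa only [inv_mul_cancel_right, mul_assoc, inv_mul_cancel_left] using mul_mem hyz hxy

theorem exists_list_prod_eq_of_mem_iSup {ι : Sort*} {G : Type*} [Group G] {S : ι → Subgroup G}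
    {x : G} (hx : x ∈ ⨆ i, S i) : ∃ l : List G, (∀ y ∈ l, ∃ i, y ∈ S i) ∧ l.prod = x := by
  refine Subgroup.iSup_induction S
    (C := fun x => ∃ l : List G, (∀ y ∈ l, ∃ i, y ∈ S i) ∧ l.prod = x) hx
    (fun i y hy => ⟨[y], ?_, List.prod_singleton⟩)
    ⟨[], List.forall_mem_nil _, List.prod_nil⟩ ?_
  · simpa only [List.forall_mem_singleton] using ⟨i, hy⟩
  · rintro _ _ ⟨l, hl, rfl⟩ ⟨l', hl', rfl⟩
    exact ⟨l ++ l', List.forall_mem_append.2 ⟨hl, hl'⟩, List.prod_append⟩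

theorem eventually_forall_mul_of_eventually {p : ℝ → Prop} (hp : ∀ᶠ t in 𝓝 0, p t) :
    ∀ᶠ t in 𝓝 (0 : ℝ), ∀ c ∈ Icc (0 : ℝ) 1, p (t * c) := by
  refine isCompact_Icc.eventually_forall_of_forall_eventually (P := fun t c => p (t * c))
    fun c _ => ?_
  have hmul : Tendsto (fun q : ℝ × ℝ => q.1 * q.2) (𝓝 (0, c)) (𝓝 0) :=
    Continuous.tendsto' (by fun_prop) _ _ (zero_mul c)
  exact hmul.eventually hp

section Isotopy

variable {n : ℕ} {M : Type u} [TopologicalSpace M] [ChartedSpace (EuclideanSpace ℝ (Fin n)) M]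
  {r : ℕ∞ω} {G : Subgroup (Diffeomorph (𝓡 n) (𝓡 n) M M r)}

/-- A group of diffeomorphisms is a full group, in the sense of Dye, if it contains every
diffeomorphism that agrees at each point with some element of the group. -/
def IsFull (G : Subgroup (Diffeomorph (𝓡 n) (𝓡 n) M M r)) : Prop :=
  ∀ f : Diffeomorph (𝓡 n) (𝓡 n) M M r, (∀ x, ∃ g ∈ G, f x = g x) → f ∈ G

theorem Foliation.isFull_leafPreserving (F : Foliation n M r) : IsFull F.leafPreserving := by
  intro f hf L hL
  have mapsTo_leaf : ∀ L ∈ F.leaves, MapsTo f L L := fun L hL x hx => by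
    obtain ⟨g, hg, hfg⟩ := hf x
    rw [hfg, ← hg L hL]
    exact mem_image_of_mem g hx
  refine Subset.antisymm (mapsTo_leaf L hL).image_subset fun y hy => ?_
  obtain ⟨x, rfl⟩ := f.surjective y
  obtain ⟨L', ⟨hL', hx⟩, -⟩ := F.isPartition.2 x
  obtain rfl := (F.isPartition.2 (f x)).unique ⟨hL, hy⟩ ⟨hL', mapsTo_leaf L' hL' hx⟩
  exact mem_image_of_mem f hx

variable {K : Set M} {f : ℝ → Diffeomorph (𝓡 n) (𝓡 n) M M r}

theorem IsIsotopyIn.inv_eq_off (hf : IsIsotopyIn G K f) (t : ℝ) {x : M} (hx : x ∉ K) :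
    (f t)⁻¹ x = x :=
  (f t).injective (((f t).apply_symm_apply x).trans (hf.eq_off t x hx).symm)

theorem IsIsotopyIn.mem_isotopyComponent (hf : IsIsotopyIn G K f) (hK : IsCompact K) {U : Set M}
    (hKU : K ⊆ U) (t : ℝ) : f t ∈ isotopyComponent G U := by
  refine ⟨K, hK, hKU, fun s => f (s * t),
    ⟨?_, fun s => hf.mem _, ?_, fun s => hf.eq_off _⟩, congrArg f (one_mul t)⟩
  · have hmul : ContDiff ℝ r fun s : ℝ => s * t := by fun_prop
    exact hf.contMDiff.comp ((hmul.contMDiff.comp contMDiff_fst).prodMk contMDiff_snd)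
  · simp only [zero_mul, hf.map_zero]

theorem isotopyComponent_le_isotopyComponent_isotopyComponent
    (G : Subgroup (Diffeomorph (𝓡 n) (𝓡 n) M M r)) (U : Set M) :
    isotopyComponent G U ≤ isotopyComponent (isotopyComponent G univ) U := by
  rintro g ⟨K, hK, hKU, f, hf, rfl⟩
  exact ⟨K, hK, hKU, f, ⟨hf.contMDiff, hf.mem_isotopyComponent hK (subset_univ K), hf.map_zero,
    hf.eq_off⟩, rfl⟩

theorem IsIsotopyIn.shift (hf : IsIsotopyIn G K f) (t : ℝ) :
    IsIsotopyIn G K fun s => f (t + s) * (f t)⁻¹ := by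
  refine ⟨?_, fun s => mul_mem (hf.mem _) (inv_mem (hf.mem t)), ?_, fun s x hx => ?_⟩
  · have hadd : ContDiff ℝ r fun s : ℝ => t + s := by fun_prop
    exact hf.contMDiff.comp ((hadd.contMDiff.comp contMDiff_fst).prodMk
      ((f t).symm.contMDiff.comp contMDiff_snd))
  · simp only [add_zero, mul_inv_cancel]
  · rw [diffeo_mul_apply, hf.inv_eq_off t hx, hf.eq_off _ x hx]

theorem IsIsotopyIn.mul_inv [IsManifold (𝓡 n) r M] (hr : 1 ≤ r) {K' : Set M}
    {f' : ℝ → Diffeomorph (𝓡 n) (𝓡 n) M M r} (hf : IsIsotopyIn G K f)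
    (hf' : IsIsotopyIn G K' f') {C D : Set M} (heq : ∀ t, EqOn (f' t) (f t) Cᶜ)
    (hmaps : ∀ t, MapsTo (f t) C D) : IsIsotopyIn G D fun t => f' t * (f t)⁻¹ := by
  refine ⟨?_, fun t => mul_mem (hf'.mem t) (inv_mem (hf.mem t)), ?_, fun t y hy => ?_⟩
  · exact hf'.contMDiff.comp (contMDiff_fst.prodMk (contMDiff_symm_family hr hf.contMDiff))
  · rw [hf.map_zero, hf'.map_zero, mul_inv_cancel]
  · obtain ⟨x, rfl⟩ := (f t).surjective y
    have hx : x ∉ C := fun hx => hy (hmaps t hx)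
    calc f' t ((f t).symm (f t x)) = f' t x := by rw [Diffeomorph.symm_apply_apply]
      _ = f t x := heq t hx

end Isotopy

section Fragmentation

variable {n : ℕ} {M : Type u} [TopologicalSpace M] [ChartedSpace (EuclideanSpace ℝ (Fin n)) M]
  {r : ℕ∞ω} {G H : Subgroup (Diffeomorph (𝓡 n) (𝓡 n) M M r)} {K : Set M}
  {g : ℝ → Diffeomorph (𝓡 n) (𝓡 n) M M r} {ψ ψ' : M → ℝ}

/-- The map moving each point `x` along the isotopy `g` up to time `τ * ψ x`; it is in general
not injective. -/
noncomputable def cutoff (g : ℝ → Diffeomorph (𝓡 n) (𝓡 n) M M r) (ψ : M → ℝ) (τ : ℝ) (x : M) : M :=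
  g (τ * ψ x) x

theorem IsIsotopyIn.contMDiff_cutoff (hg : IsIsotopyIn G K g) (hψ : ContMDiff (𝓡 n) 𝓘(ℝ, ℝ) r ψ) :
    ContMDiff (𝓘(ℝ, ℝ).prod (𝓡 n)) (𝓡 n) r (fun p : ℝ × M => cutoff g ψ p.1 p.2) := by
  have htime : ContMDiff (𝓘(ℝ, ℝ).prod (𝓡 n)) 𝓘(ℝ, ℝ) r (fun p : ℝ × M => p.1 * ψ p.2) :=
    (contDiff_mul (𝕜 := ℝ) (𝔸 := ℝ)).contMDiff.comp
      (contMDiff_fst.prodMk_space (hψ.comp contMDiff_snd))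
  exact hg.contMDiff.comp (htime.prodMk contMDiff_snd)

theorem IsIsotopyIn.cutoff_zero_time (hg : IsIsotopyIn G K g) (ψ : M → ℝ) : cutoff g ψ 0 = id := by
  funext x
  rw [cutoff, zero_mul, hg.map_zero, diffeo_one_apply, id]

theorem IsIsotopyIn.eventually_exists_eq_cutoff [T2Space M] [IsManifold (𝓡 n) r M] (hr : 1 ≤ r)
    (hG : IsFull G) (hK : IsCompact K) (hg : IsIsotopyIn G K g)
    (hψ : ContMDiff (𝓡 n) 𝓘(ℝ, ℝ) r ψ) :
    ∀ᶠ τ in 𝓝 0, ∃ d ∈ G, ⇑d = cutoff g ψ τ := by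
  have : LocallyCompactSpace M := Manifold.locallyCompact_of_finiteDimensional (𝓡 n)
  filter_upwards [eventually_exists_diffeomorph hr (hg.contMDiff_cutoff hψ)
    (hg.cutoff_zero_time ψ) hK fun τ x hx => hg.eq_off _ x hx] with τ ⟨d, hd⟩
  exact ⟨d, hG d fun x => ⟨g (τ * ψ x), hg.mem _, congrFun hd x⟩, hd⟩

theorem IsIsotopyIn.eventually_exists_isotopy_cutoff [T2Space M] [IsManifold (𝓡 n) r M]
    (hr : 1 ≤ r) (hr' : r ≤ ∞) (hG : IsFull G) (hK : IsCompact K) (hg : IsIsotopyIn G K g)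
    (hψ : ContMDiff (𝓡 n) 𝓘(ℝ, ℝ) r ψ) :
    ∀ᶠ τ in 𝓝 0, ∃ f, IsIsotopyIn G K f ∧
      ∀ s, ⇑(f s) = cutoff g ψ (τ * Real.smoothTransition s) := by
  filter_upwards [eventually_forall_mul_of_eventually
    (hg.eventually_exists_eq_cutoff hr hG hK hψ)] with τ hτ
  choose f hf hfτ using fun s =>
    hτ _ ⟨Real.smoothTransition.nonneg s, Real.smoothTransition.le_one s⟩
  refine ⟨f, ⟨?_, hf, Diffeomorph.ext fun x => ?_, fun s x hx => ?_⟩, hfτ⟩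
  · have htime : ContDiff ℝ r fun s => τ * Real.smoothTransition s :=
      contDiff_const.mul (Real.smoothTransition.contDiff.of_le hr')
    simp only [hfτ]
    exact (hg.contMDiff_cutoff hψ).comp
      ((htime.contMDiff.comp contMDiff_fst).prodMk contMDiff_snd)
  · rw [hfτ, Real.smoothTransition.zero, mul_zero, hg.cutoff_zero_time ψ]
    rfl
  · rw [hfτ]
    exact hg.eq_off _ x hx

theorem IsIsotopyIn.eventually_mul_inv_mem_isotopyComponent [T2Space M] [IsManifold (𝓡 n) r M]
    (hr : 1 ≤ r) (hr' : r ≤ ∞) (hG : IsFull G) (hK : IsCompact K) (hg : IsIsotopyIn G K g)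
    (hψ : ContMDiff (𝓡 n) 𝓘(ℝ, ℝ) r ψ) (hψ' : ContMDiff (𝓡 n) 𝓘(ℝ, ℝ) r ψ') {C U : Set M}
    (hC : IsCompact C) (hU : IsOpen U) (hCU : C ⊆ U) (heq : EqOn ψ' ψ Cᶜ) :
    ∀ᶠ τ in 𝓝 0, ∃ d d' : Diffeomorph (𝓡 n) (𝓡 n) M M r, ⇑d = cutoff g ψ τ ∧
      ⇑d' = cutoff g ψ' τ ∧ d' * d⁻¹ ∈ isotopyComponent G U := by
  have hcont : Continuous fun p : ℝ × M => cutoff g ψ p.1 p.2 := (hg.contMDiff_cutoff hψ).continuous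
  have hmaps : ∀ᶠ τ in 𝓝 0, ∀ x ∈ C, cutoff g ψ τ x ∈ U := by
    refine hC.eventually_forall_of_forall_eventually fun x hx => ?_
    refine hcont.continuousAt.eventually_mem (x := (0, x)) ?_
    simpa only [hg.cutoff_zero_time ψ, id_eq] using hU.mem_nhds (hCU hx)
  filter_upwards [eventually_forall_mul_of_eventually hmaps,
    hg.eventually_exists_isotopy_cutoff hr hr' hG hK hψ,
    hg.eventually_exists_isotopy_cutoff hr hr' hG hK hψ'] with τ hmaps ⟨f, hf, hfτ⟩ ⟨f', hf', hfτ'⟩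
  let D : Set M := (fun p : ℝ × M => cutoff g ψ (τ * p.1) p.2) '' (Icc 0 1 ×ˢ C)
  have hD : IsCompact D := (isCompact_Icc.prod hC).image
    (hcont.comp ((continuous_const.mul continuous_fst).prodMk continuous_snd))
  have hDU : D ⊆ U := by
    rintro _ ⟨⟨c, x⟩, ⟨hc, hx⟩, rfl⟩
    exact hmaps c hc x hx
  have hf_maps : ∀ s, MapsTo (f s) C D := fun s x hx => by
    rw [hfτ]
    exact ⟨(_, x), ⟨⟨Real.smoothTransition.nonneg s, Real.smoothTransition.le_one s⟩, hx⟩, rfl⟩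
  have hf_eq : ∀ s, EqOn (f' s) (f s) Cᶜ := fun s x hx => by
    rw [hfτ, hfτ', cutoff, cutoff, heq hx]
  refine ⟨f 1, f' 1, ?_, ?_, (hf.mul_inv hr hf' hf_eq hf_maps).mem_isotopyComponent hD hDU 1⟩
  · rw [hfτ, Real.smoothTransition.one, mul_one]
  · rw [hfτ', Real.smoothTransition.one, mul_one]

/-- Some `C^r` function `ψ` equal to `1` on `u` cuts the isotopy `g` off to elements of `H`, for
all small times. -/
def HasCutoffIn (H : Subgroup (Diffeomorph (𝓡 n) (𝓡 n) M M r))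
    (g : ℝ → Diffeomorph (𝓡 n) (𝓡 n) M M r) (u : Set M) : Prop :=
  ∃ ψ : M → ℝ, ContMDiff (𝓡 n) 𝓘(ℝ, ℝ) r ψ ∧ EqOn ψ 1 u ∧
    ∀ᶠ τ in 𝓝 0, ∃ d ∈ H, ⇑d = cutoff g ψ τ

theorem HasCutoffIn.mono {u v : Set M} (huv : u ⊆ v) (hv : HasCutoffIn H g v) :
    HasCutoffIn H g u :=
  let ⟨ψ, hψ, hone, hmem⟩ := hv
  ⟨ψ, hψ, hone.mono huv, hmem⟩

theorem IsIsotopyIn.hasCutoffIn_empty (hg : IsIsotopyIn G K g) : HasCutoffIn H g ∅ := by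
  refine ⟨0, contMDiff_const, eqOn_empty _ _, .of_forall fun τ => ⟨1, one_mem H, ?_⟩⟩
  funext x
  rw [cutoff, Pi.zero_apply, mul_zero, hg.map_zero]

theorem contMDiff_smoothBumpFunction {E : Type*} [NormedAddCommGroup E] [NormedSpace ℝ E]
    [FiniteDimensional ℝ E] {A : Type*} [TopologicalSpace A] {I : ModelWithCorners ℝ E A}
    {N : Type*} [TopologicalSpace N] [T2Space N] [ChartedSpace A N] [IsManifold I r N]
    (hr : r ≤ ∞) {c : N} (f : SmoothBumpFunction I c) : ContMDiff I 𝓘(ℝ, ℝ) r f := by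
  refine contMDiff_of_tsupport fun x hx => ?_
  have hx_source : x ∈ (chartAt A c).source := f.tsupport_subset_chartAt_source hx
  refine ContMDiffAt.congr_of_eventuallyEq ?_
    (f.eqOn_source.eventuallyEq_of_mem ((chartAt A c).open_source.mem_nhds hx_source))
  exact (f.contDiffAt.of_le (mod_cast hr)).contMDiffAt.comp x (contMDiffAt_extChartAt' hx_source)

theorem HasCutoffIn.union [T2Space M] [IsManifold (𝓡 n) r M] (hr : 1 ≤ r) (hr' : r ≤ ∞)
    (hG : IsFull G) (hK : IsCompact K) (hg : IsIsotopyIn G K g) {U : Set M} (hU : IsOpen U)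
    (hH : isotopyComponent G U ≤ H) {μ : M → ℝ} (hμ : ContMDiff (𝓡 n) 𝓘(ℝ, ℝ) r μ)
    (hμc : HasCompactSupport μ) (hμU : tsupport μ ⊆ U) {u v : Set M} (hμv : EqOn μ 1 v)
    (hu : HasCutoffIn H g u) : HasCutoffIn H g (u ∪ v) := by
  obtain ⟨ψ, hψ, hone, hmem⟩ := hu
  let ψ' : M → ℝ := fun x => ψ x + (1 - ψ x) * μ x
  have hψ' : ContMDiff (𝓡 n) 𝓘(ℝ, ℝ) r ψ' := by
    have hpoly : ContDiff ℝ r (fun p : ℝ × ℝ => p.1 + (1 - p.1) * p.2) := by fun_prop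
    exact hpoly.contMDiff.comp (hψ.prodMk_space hμ)
  have heq : EqOn ψ' ψ (tsupport μ)ᶜ := fun x hx => by
    simp only [ψ', image_eq_zero_of_notMem_tsupport hx, mul_zero, add_zero]
  refine ⟨ψ', hψ', ?_, ?_⟩
  · rintro x (hx | hx)
    · simp only [ψ', hone hx, Pi.one_apply, sub_self, zero_mul, add_zero]
    · simp only [ψ', hμv hx, Pi.one_apply, mul_one, add_sub_cancel]
  · filter_upwards [hmem, hg.eventually_mul_inv_mem_isotopyComponent hr hr' hG hK hψ hψ'
      hμc hU hμU heq] with τ ⟨d, hdH, hd⟩ ⟨e, e', he, he', hquot⟩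
    obtain rfl : d = e := Diffeomorph.coeFn_injective (hd.trans he.symm)
    exact ⟨e', by simpa only [inv_mul_cancel_right] using mul_mem (hH hquot) hdH, he'⟩

variable {𝒰 : Set (Set M)}

theorem IsIsotopyIn.hasCutoffIn_of_isCompact [T2Space M] [IsManifold (𝓡 n) r M] (hr : 1 ≤ r)
    (hr' : r ≤ ∞) (hG : IsFull G) (hK : IsCompact K) (hg : IsIsotopyIn G K g)
    (hopen : ∀ U ∈ 𝒰, IsOpen U) (hcover : ⋃₀ 𝒰 = univ) (hH : ∀ U ∈ 𝒰, isotopyComponent G U ≤ H)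
    {L : Set M} (hL : IsCompact L) : HasCutoffIn H g L := by
  have extend : ∀ u, HasCutoffIn H g u → HasCutoffIn H g (u ∪ L) := by
    refine hL.induction_on (p := fun s => ∀ u, HasCutoffIn H g u → HasCutoffIn H g (u ∪ s))
      (fun u hu => ?_) (fun s t hst ht u hu => (ht u hu).mono (union_subset_union_right u hst))
      (fun s t hs ht u hu => ?_) (fun x _ => ?_)
    · rwa [union_empty]
    · simpa only [union_assoc] using ht _ (hs u hu)
    · obtain ⟨U, hU𝒰, hxU⟩ := mem_sUnion.1 (hcover ▸ mem_univ x)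
      obtain ⟨μ, -, hμU⟩ := (SmoothBumpFunction.nhds_basis_tsupport (I := 𝓡 n) x).mem_iff.1
        ((hopen U hU𝒰).mem_nhds hxU)
      exact ⟨{y | μ y = 1}, mem_nhdsWithin_of_mem_nhds μ.eventuallyEq_one, fun u hu =>
        hu.union hr hr' hG hK hg (hopen U hU𝒰) (hH U hU𝒰) (contMDiff_smoothBumpFunction hr' μ)
          μ.hasCompactSupport hμU fun y hy => hy⟩
  simpa only [empty_union] using extend ∅ hg.hasCutoffIn_empty

theorem HasCutoffIn.eventually_mem (hg : IsIsotopyIn G K g) (h : HasCutoffIn H g K) :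
    ∀ᶠ τ in 𝓝 0, g τ ∈ H := by
  obtain ⟨ψ, -, hone, hmem⟩ := h
  filter_upwards [hmem] with τ ⟨d, hdH, hd⟩
  suffices hgd : g τ = d from hgd ▸ hdH
  refine Diffeomorph.ext fun x => ?_
  rw [hd, cutoff]
  by_cases hx : x ∈ K
  · rw [hone hx, Pi.one_apply, mul_one]
  · rw [hg.eq_off _ x hx, hg.eq_off _ x hx]

theorem isotopyComponent_univ_le [T2Space M] [IsManifold (𝓡 n) r M] (hr : 1 ≤ r) (hr' : r ≤ ∞)
    (hG : IsFull G) (hopen : ∀ U ∈ 𝒰, IsOpen U) (hcover : ⋃₀ 𝒰 = univ)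
    (hH : ∀ U ∈ 𝒰, isotopyComponent G U ≤ H) : isotopyComponent G univ ≤ H := by
  rintro _ ⟨K, hK, -, f, hf, rfl⟩
  have local_quotient : ∀ t, ∀ᶠ s in 𝓝 t, f s * (f t)⁻¹ ∈ H := fun t => by
    have hshift := (hf.shift t).hasCutoffIn_of_isCompact hr hr' hG hK hopen hcover hH hK
    have hsub : Tendsto (fun s => s - t) (𝓝 t) (𝓝 0) :=
      (continuous_sub_right t).tendsto' t 0 (sub_self t)
    simpa only [add_sub_cancel] using hsub.eventually (hshift.eventually_mem (hf.shift t))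
  simpa only [hf.map_zero, inv_one, mul_one] using mul_inv_mem_of_eventually local_quotient 0 1

end Fragmentation

end FoliatedManifold

open FoliatedManifold in
theorem proposition2p11_general {n : ℕ} {M : Type u} [TopologicalSpace M] [T2Space M]
    [ChartedSpace (EuclideanSpace ℝ (Fin n)) M] {r : ℕ∞ω} [IsManifold (𝓡 n) r M]
    (hr : 1 ≤ r) (hr' : r ≤ ∞) {G : Subgroup (Diffeomorph (𝓡 n) (𝓡 n) M M r)} (hG : IsFull G) :
    IsFactorizable (isotopyComponent G Set.univ) := by
  intro 𝒰 hopen hcover g hg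
  have hle : isotopyComponent G Set.univ ≤ ⨆ U : 𝒰, isotopyComponent G U.1 :=
    isotopyComponent_univ_le hr hr' hG hopen hcover fun U hU =>
      le_iSup (fun U : 𝒰 => isotopyComponent G U.1) ⟨U, hU⟩
  obtain ⟨l, hl, hprod⟩ := exists_list_prod_eq_of_mem_iSup (hle hg)
  refine ⟨l, fun h hh => ?_, hprod⟩
  obtain ⟨⟨U, hU⟩, hhU⟩ := hl h hh
  exact ⟨U, hU, isotopyComponent_le_isotopyComponent_isotopyComponent G U hhU⟩

theorem proposition2p11 (n : ℕ) (M : Type u) [TopologicalSpace M] [T2Space M]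
    [ParacompactSpace M] [ChartedSpace (EuclideanSpace ℝ (Fin n)) M]
    [IsManifold (𝓡 n) ∞ M] (r : ℕ∞) (hr : 1 ≤ r)
    (F : FoliatedManifold.Foliation n M (r : ℕ∞ω)) :
    FoliatedManifold.IsFactorizable F.group := by
  have hr' : (r : ℕ∞ω) ≤ ∞ := mod_cast le_top
  have : IsManifold (𝓡 n) (r : ℕ∞ω) M := IsManifold.of_le hr'
  exact proposition2p11_general (mod_cast hr) hr' F.isFull_leafPreserving
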